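/- A finite bipartite graph $F$ consists of two finite vertex sets $V_1(F), V_2(F) \subset \mathbb{N}$ and an edge set $E(F) \subseteq V_1(F) \times V_2(F)$; the union $F_1 \cup F_2$ of two such graphs has vertex sets $V_j(F_1)\cup V_j(F_2)$, $j=1,2$, and edge set $E(F_1)\cup E(F_2)$. Let $\mathcal{B}^L_{\infty\infty}$ be the set of labelled infinite bipartite graphs $H$ with $V_1(H) = V_2(H) = \mathbb{N}$ and $E(H) \subseteq \mathbb{N}\times\mathbb{N}$, with the product topology (of the edge indicators) and its Borel $\sigma$-field; $H \supset F$ means $E(F) \subseteq E(H)$. A probability distribution on $\mathcal{B}^L_{\infty\infty}$ is exchangeable if it is invariant under every pair $(\sigma,\tau)$ of finite permutations of $\mathbb{N}$, where $\sigma$ permutes $V_1(H)$ and $\tau$ permutes $V_2(H)$ (a permutation is finite if it moves only finitely many elements). A random element $H$ of $\mathcal{B}^L_{\infty\infty}$ is exchangeable if its distribution is. **Theorem.** Let $H$ be an exchangeable random infinite bipartite graph. Then the following are equivalent. (i) The distribution of $H$ is an extreme point in the (convex) set of exchangeable probability distributions on $\mathcal{B}^L_{\infty\infty}$. (ii) If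 $F_1$ and $F_2$ are two finite bipartite graphs such that, for $j=1,2$, the vertex sets $V_j(F_1)$ and $V_j(F_2)$ are disjoint subsets of $\mathbb{N}$, then $$\mathbb{P}(H\supset F_1\cup F_2)=\mathbb{P}(H\supset F_1)\,\mathbb{P}(H\supset F_2).$$ -/

import Mathlib

open MeasureTheory Set
open scoped NNReal

/-- A finite bipartite graph with an explicit bipartition, whose two vertex sets are finite sets of
integer labels. The two parts are kept apart by their position, so `V₁` and `V₂` may use the same
labels. -/
structure FinBipartiteGraph where
  V₁ : Finset ℕ
  V₂ : Finset ℕ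
  E : Finset (ℕ × ℕ)
  edge_mem : E ⊆ V₁ ×ˢ V₂

/-- The union of two finite bipartite graphs (union in each part, and of the edge sets). -/
instance : Union FinBipartiteGraph where
  union F G :=
    { V₁ := F.V₁ ∪ G.V₁
      V₂ := F.V₂ ∪ G.V₂
      E := F.E ∪ G.E
      edge_mem := Finset.union_subset
        (F.edge_mem.trans
          (Finset.product_subset_product Finset.subset_union_left Finset.subset_union_left))
        (G.edge_mem.trans
          (Finset.product_subset_product Finset.subset_union_right Finset.subset_union_right)) }

/-- Labelled infinite bipartite graphs, both of whose vertex sets are the set of all labels `ℕ`.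
Such a graph is its edge set, a subset of `ℕ × ℕ`. The measurable structure is that of
`Set (ℕ × ℕ)`, the product σ-algebra on the edge indicators, which is the Borel σ-algebra of the
product topology. -/
abbrev InfBipartiteGraph : Type := Set (ℕ × ℕ)

namespace InfBipartiteGraph

/-- `H ⊇ F`: every edge of the finite bipartite graph `F` is an edge of `H`. (The vertices of `F`
are vertices of `H` in any case.) -/
def Contains (H : InfBipartiteGraph) (F : FinBipartiteGraph) : Prop :=
  (F.E : Set (ℕ × ℕ)) ⊆ H

/-- Relabel the vertices of the first part by `σ` and those of the second part by `τ`: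
`(i, j)` is an edge of `H` iff `(σ i, τ j)` is an edge of `H.relabel σ τ`. -/
def relabel (σ τ : Equiv.Perm ℕ) (H : InfBipartiteGraph) : InfBipartiteGraph :=
  {e | (σ.symm e.1, τ.symm e.2) ∈ H}

theorem measurable_relabel (σ τ : Equiv.Perm ℕ) : Measurable (relabel σ τ) :=
  measurable_set_iff.2 fun e => measurable_set_mem (σ.symm e.1, τ.symm e.2)

end InfBipartiteGraph

/-- A permutation of `ℕ` is finite if it moves only finitely many elements. -/
def IsFinitePerm (σ : Equiv.Perm ℕ) : Prop := {i | σ i ≠ i}.Finite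

/-- A distribution on infinite bipartite graphs is exchangeable if it is invariant under every pair
of finite permutations of the two vertex sets. -/
def IsExchangeableLaw (μ : Measure InfBipartiteGraph) : Prop :=
  ∀ σ τ : Equiv.Perm ℕ, IsFinitePerm σ → IsFinitePerm τ →
    μ.map (InfBipartiteGraph.relabel σ τ) = μ

/-- The set of exchangeable probability distributions on infinite bipartite graphs. -/
def exchangeableLaws : Set (Measure InfBipartiteGraph) :=
  {μ | IsProbabilityMeasure μ ∧ IsExchangeableLaw μ}

/-! Extreme implies product rule: translate `F₂` far away and let `B k` be the event that `H`
contains the translate. Each finite permutation eventually fixes `B k`, so the limits of `μ`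
restricted to `B k` and to its complement, along a nonprincipal ultrafilter, are exchangeable and
sum to `μ`. By extremality (`eq_smul_of_mem_extremePoints`) the first limit is a multiple of `μ`.
Its mass is the probability of containing `F₂`, and its value on containment of `F₁` is the joint
probability, since translating `F₂` far out leaves that unchanged.

Product rule implies extreme: under any exchangeable law, the probability of two far apart copies of
`E` is at least the square of that of one (`sq_measureReal_le`). The product rule makes this an
equality for `μ`; strict convexity of the square then forces the components of a mixture to agree on
every containment event, and these events determine the law. -/

open Filter Topology

/-! ### Setwise limits of dominated measures -/

/-- A sequence of measures dominated by a finite measure converges setwise along every ultrafilter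
to a measure. -/
theorem exists_measure_tendsto_ultrafilter {α ι : Type*} [MeasurableSpace α] (μ : Measure α)
    [IsFiniteMeasure μ] (ν : ι → Measure α) (hν : ∀ k, ν k ≤ μ) (U : Ultrafilter ι) :
    ∃ ρ : Measure α, ∀ C, MeasurableSet C → Tendsto (fun k => ν k C) U (𝓝 (ρ C)) := by
  have hfin : ∀ k, IsFiniteMeasure (ν k) := fun k => isFiniteMeasure_of_le μ (hν k)
  have hle : ∀ k C, (ν k).real C ≤ μ.real C := fun k C =>
    ENNReal.toReal_mono (measure_ne_top μ C) (hν k C)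
  have hlim : ∀ C, ∃ x : ℝ, Tendsto (fun k => (ν k).real C) U (𝓝 x) := by
    intro C
    have hmem : Icc 0 (μ.real C) ∈ U.map (fun k => (ν k).real C) := by
      rw [Ultrafilter.mem_map]
      exact univ_mem' fun k => ⟨measureReal_nonneg, hle k C⟩
    obtain ⟨x, -, hx⟩ := isCompact_Icc.ultrafilter_le_nhds' _ hmem
    exact ⟨x, hx⟩
  choose r hr using hlim
  have hr0 : ∀ C, 0 ≤ r C := fun C =>
    ge_of_tendsto' (hr C) fun k => measureReal_nonneg
  have hrμ : ∀ C, r C ≤ μ.real C := fun C => le_of_tendsto' (hr C) fun k => hle k C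
  have hunion : ∀ f : ℕ → Set α, (∀ i, MeasurableSet (f i)) → Pairwise (Function.onFun Disjoint f) →
      Summable (fun i => r (f i)) ∧ r (⋃ i, f i) = ∑' i, r (f i) := by
    intro f hf hd
    have hsum : ∀ (m : Measure α) [IsFiniteMeasure m],
        HasSum (fun i => m.real (f i)) (m.real (⋃ i, f i)) := by
      intro m _
      have h := measure_iUnion (μ := m) hd hf
      have h' : m.real (⋃ i, f i) = ∑' i, m.real (f i) := by
        rw [measureReal_def, h, ENNReal.tsum_toReal_eq fun i => measure_ne_top m _]
        rfl
      rw [h']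
      exact (ENNReal.summable_toReal (h ▸ measure_ne_top m _)).hasSum
    refine ⟨(hsum μ).summable.of_nonneg_of_le (fun i => hr0 _) fun i => hrμ _, ?_⟩
    -- Domination by the summable masses `μ (f i)` lets the limit pass through the sum; this is what
    -- yields countable additivity.
    have ht := tendsto_tsum_of_dominated_convergence (𝓕 := (U : Filter ι)) (hsum μ).summable
      (fun i => hr (f i)) (Eventually.of_forall fun k i => by
        rw [Real.norm_of_nonneg measureReal_nonneg]; exact hle k _)
    refine tendsto_nhds_unique (hr _) (ht.congr fun k => ?_)
    exact (hsum (ν k)).tsum_eq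
  refine ⟨Measure.ofMeasurable (fun C _ => ENNReal.ofReal (r C)) ?_ ?_, fun C hC => ?_⟩
  · have h0 : r ∅ ≤ 0 := by simpa using hrμ ∅
    simpa using h0
  · intro f hf hd
    obtain ⟨hs, he⟩ := hunion f hf hd
    rw [he, ENNReal.ofReal_tsum_of_nonneg (fun i => hr0 _) hs]
  · rw [Measure.ofMeasurable_apply _ hC]
    refine ((ENNReal.continuous_ofReal.tendsto _).comp (hr C)).congr fun k => ?_
    exact ofReal_measureReal

/-! ### Finite permutations and containment events -/

/-- A map that is injective on a finite set agrees there with a finite permutation. -/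
theorem exists_isFinitePerm_eqOn (s : Finset ℕ) (f : ℕ → ℕ) (hf : InjOn f s) :
    ∃ σ : Equiv.Perm ℕ, IsFinitePerm σ ∧ ∀ x ∈ s, σ x = f x := by
  classical
  induction s using Finset.induction_on with
  | empty => exact ⟨1, by simp [IsFinitePerm], by simp⟩
  | insert a s ha ih =>
    obtain ⟨σ, hσ, h⟩ := ih (hf.mono (by simp))
    -- The swap corrects the value at `a`; injectivity of `σ` and of `f` keeps it off the values on
    -- `s`.
    refine ⟨Equiv.swap (σ a) (f a) * σ, ?_, fun x hx => ?_⟩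
    · refine (hσ.union (Set.toFinite {a, σ.symm (f a)})).subset fun x hx => ?_
      by_contra hcon
      simp only [mem_union, mem_ofPred_eq, mem_insert_iff, mem_singleton_iff, not_or, not_not]
        at hcon
      obtain ⟨h1, h2, h3⟩ := hcon
      apply hx
      rw [Equiv.Perm.mul_apply, Equiv.swap_apply_of_ne_of_ne, h1]
      · exact fun h => h2 (σ.injective h)
      · exact fun h => h3 (by rw [← h, Equiv.symm_apply_apply])
    · rw [Equiv.Perm.mul_apply]
      rcases Finset.mem_insert.1 hx with rfl | hxs
      · exact Equiv.swap_apply_left _ _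
      · have hne : x ≠ a := fun h => ha (h ▸ hxs)
        rw [Equiv.swap_apply_of_ne_of_ne (fun h => hne (σ.injective h)), h x hxs]
        rw [h x hxs]
        exact fun hfx => hne (hf (by simp [hxs]) (by simp) hfx)

namespace InfBipartiteGraph

/-- The set of infinite bipartite graphs that have all the edges in `E`. -/
def supersets (E : Finset (ℕ × ℕ)) : Set InfBipartiteGraph := {H | (E : Set (ℕ × ℕ)) ⊆ H}

theorem mem_supersets {E : Finset (ℕ × ℕ)} {H : InfBipartiteGraph} :
    H ∈ supersets E ↔ ∀ e ∈ E, e ∈ H := Iff.rfl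

theorem supersets_union (E F : Finset (ℕ × ℕ)) :
    supersets (E ∪ F) = supersets E ∩ supersets F := by
  ext H
  simp [supersets]

theorem measurableSet_supersets (E : Finset (ℕ × ℕ)) : MeasurableSet (supersets E) := by
  have h : supersets E = ⋂ e ∈ E, {H : InfBipartiteGraph | e ∈ H} := by
    ext H
    simp [mem_supersets]
  rw [h]
  exact E.measurableSet_biInter fun e _ => measurableSet_setOfPred.2 (measurable_set_mem e)

theorem isPiSystem_range_supersets : IsPiSystem (range supersets) := by
  rintro _ ⟨E, rfl⟩ _ ⟨F, rfl⟩ -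
  exact ⟨E ∪ F, supersets_union E F⟩

theorem generateFrom_range_supersets :
    (inferInstance : MeasurableSpace InfBipartiteGraph) =
      MeasurableSpace.generateFrom (range supersets) := by
  apply le_antisymm
  · have h : @Measurable _ _ (MeasurableSpace.generateFrom (range supersets)) _
        (id : InfBipartiteGraph → InfBipartiteGraph) := by
      refine (@measurable_set_iff _ _ (MeasurableSpace.generateFrom (range supersets)) _).2
        fun e => ?_
      refine (@measurableSet_setOfPred _ (MeasurableSpace.generateFrom (range supersets)) _).1 ?_
      refine MeasurableSpace.measurableSet_generateFrom ⟨{e}, ?_⟩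
      ext H
      simp [mem_supersets]
    intro s hs
    exact h hs
  · refine MeasurableSpace.generateFrom_le ?_
    rintro _ ⟨E, rfl⟩
    exact measurableSet_supersets E

/-- A law of infinite bipartite graphs is determined by the containment probabilities. -/
theorem measure_ext_supersets {μ ν : Measure InfBipartiteGraph} [IsProbabilityMeasure μ]
    (h : ∀ E, μ (supersets E) = ν (supersets E)) : μ = ν := by
  refine ext_of_generate_finite _ generateFrom_range_supersets isPiSystem_range_supersets ?_ ?_
  · rintro _ ⟨E, rfl⟩
    exact h E
  · have h0 : supersets ∅ = univ := by ext H; simp [mem_supersets]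
    rw [← h0, h]

theorem relabel_preimage_supersets (σ τ : Equiv.Perm ℕ) (E : Finset (ℕ × ℕ)) :
    relabel σ τ ⁻¹' supersets (E.image (Prod.map σ τ)) = supersets E := by
  ext H
  simp only [mem_preimage, mem_supersets, Finset.forall_mem_image]
  simp [relabel]

end InfBipartiteGraph

open InfBipartiteGraph

namespace IsExchangeableLaw

variable {μ : Measure InfBipartiteGraph}

theorem measure_preimage (hμ : IsExchangeableLaw μ) {σ τ : Equiv.Perm ℕ} (hσ : IsFinitePerm σ)
    (hτ : IsFinitePerm τ) {C : Set InfBipartiteGraph} (hC : MeasurableSet C) :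
    μ (relabel σ τ ⁻¹' C) = μ C := by
  conv_rhs => rw [← hμ σ τ hσ hτ]
  rw [Measure.map_apply (measurable_relabel σ τ) hC]

/-- Containment probabilities are invariant under relabelling by maps that are injective on the
vertices involved. -/
theorem measure_supersets_image (hμ : IsExchangeableLaw μ) (E : Finset (ℕ × ℕ)) (f g : ℕ → ℕ)
    (hf : InjOn f (E.image Prod.fst)) (hg : InjOn g (E.image Prod.snd)) :
    μ (supersets (E.image (Prod.map f g))) = μ (supersets E) := by
  obtain ⟨σ, hσ, hσf⟩ := exists_isFinitePerm_eqOn _ f hf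
  obtain ⟨τ, hτ, hτg⟩ := exists_isFinitePerm_eqOn _ g hg
  have h : E.image (Prod.map f g) = E.image (Prod.map σ τ) := by
    refine Finset.image_congr fun e he => ?_
    exact Prod.ext (hσf _ (Finset.mem_image_of_mem _ he)).symm
      (hτg _ (Finset.mem_image_of_mem _ he)).symm
  rw [h, ← relabel_preimage_supersets σ τ E,
    hμ.measure_preimage hσ hτ (measurableSet_supersets _)]

end IsExchangeableLaw

/-! ### Translated copies -/

/-- The edge set `E` with all vertices in both parts moved up by `k`. -/
def shiftEdges (E : Finset (ℕ × ℕ)) (k : ℕ) : Finset (ℕ × ℕ) :=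
  E.image (Prod.map (· + k) (· + k))

namespace IsExchangeableLaw

variable {μ : Measure InfBipartiteGraph}

theorem measure_supersets_shiftEdges (hμ : IsExchangeableLaw μ) (E : Finset (ℕ × ℕ)) (k : ℕ) :
    μ (supersets (shiftEdges E k)) = μ (supersets E) :=
  hμ.measure_supersets_image E _ _ (add_left_injective k).injOn (add_left_injective k).injOn

/-- Fixing the vertices of `F₁` and translating the others is injective once `k` exceeds every label
of `F₁`, so exchangeability applies. -/
theorem eventually_measure_inter_shiftEdges (hμ : IsExchangeableLaw μ) (F₁ F₂ : FinBipartiteGraph)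
    (h₁ : Disjoint F₁.V₁ F₂.V₁) (h₂ : Disjoint F₁.V₂ F₂.V₂) :
    ∀ᶠ k in atTop, μ (supersets F₁.E ∩ supersets (shiftEdges F₂.E k)) =
      μ (supersets (F₁.E ∪ F₂.E)) := by
  obtain ⟨N, hN⟩ : ∃ N, ∀ x ∈ F₁.V₁ ∪ F₁.V₂, x < N :=
    ⟨(F₁.V₁ ∪ F₁.V₂).sup id + 1, fun x hx => Nat.lt_succ_of_le (Finset.le_sup (f := id) hx)⟩
  filter_upwards [eventually_ge_atTop N] with k hk
  have hinj : ∀ V W : Finset ℕ, (∀ x ∈ V, x < N) →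
      InjOn (fun x => if x ∈ V then x else x + k) ((V ∪ W : Finset ℕ) : Set ℕ) := by
    intro V W hV x _ y _ hxy
    have hx := hV x
    have hy := hV y
    grind
  have hE₁ : ∀ e ∈ F₁.E, e.1 ∈ F₁.V₁ ∧ e.2 ∈ F₁.V₂ := fun e he =>
    Finset.mem_product.1 (F₁.edge_mem he)
  have hE₂ : ∀ e ∈ F₂.E, e.1 ∈ F₂.V₁ ∧ e.2 ∈ F₂.V₂ := fun e he =>
    Finset.mem_product.1 (F₂.edge_mem he)
  have h := hμ.measure_supersets_image (F₁.E ∪ F₂.E)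
    (fun x => if x ∈ F₁.V₁ then x else x + k) (fun x => if x ∈ F₁.V₂ then x else x + k)
    ((hinj F₁.V₁ F₂.V₁ fun x hx => hN x (Finset.mem_union_left _ hx)).mono (by
      intro x hx
      simp only [Finset.coe_image, mem_image, Finset.mem_coe, Finset.mem_union] at hx ⊢
      obtain ⟨e, he | he, rfl⟩ := hx
      · exact Or.inl (hE₁ e he).1
      · exact Or.inr (hE₂ e he).1))
    ((hinj F₁.V₂ F₂.V₂ fun x hx => hN x (Finset.mem_union_right _ hx)).mono (by
      intro x hx
      simp only [Finset.coe_image, mem_image, Finset.mem_coe, Finset.mem_union] at hx ⊢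
      obtain ⟨e, he | he, rfl⟩ := hx
      · exact Or.inl (hE₁ e he).2
      · exact Or.inr (hE₂ e he).2))
  rw [← h, Finset.image_union, supersets_union, shiftEdges]
  congr 3
  · refine Finset.image_id.symm.trans (Finset.image_congr fun e he => ?_)
    simp [Prod.map, (hE₁ e he).1, (hE₁ e he).2]
  · refine Finset.image_congr fun e he => ?_
    have h1 := Finset.disjoint_right.1 h₁ (hE₂ e he).1
    have h2 := Finset.disjoint_right.1 h₂ (hE₂ e he).2
    simp [Prod.map, h1, h2]

/-- Two copies of an edge set that are moved far apart are jointly contained with a probability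
that does not depend on the copies. -/
theorem measure_inter_shiftEdges_mul (hμ : IsExchangeableLaw μ) {N : ℕ}
    {E : Finset (ℕ × ℕ)} (hN : ∀ e ∈ E, e.1 < N ∧ e.2 < N) {i j : ℕ} (hij : i ≠ j) :
    μ (supersets (shiftEdges E (i * N)) ∩ supersets (shiftEdges E (j * N))) =
      μ (supersets (E ∪ shiftEdges E N)) := by
  -- Carries the block `[0, N)` onto block `i` and `[N, 2N)` onto block `j`.
  set f : ℕ → ℕ := fun x => if x < N then x + i * N else x - N + j * N with hf
  have hinj : InjOn f (Iio (2 * N)) := by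
    have key : ∀ a b x y : ℕ, a < b → x < N → y < N → x + a * N < y + b * N := by
      intro a b x y hab hx hy
      have : (a + 1) * N ≤ b * N := Nat.mul_le_mul_right N hab
      rw [Nat.add_mul, Nat.one_mul] at this
      omega
    have key' : ∀ x y : ℕ, x < N → y < N → x + i * N ≠ y + j * N := by
      intro x y hx hy
      rcases lt_or_gt_of_ne hij with h | h
      · exact (key i j x y h hx hy).ne
      · exact (key j i y x h hy hx).ne'
    intro x hx y hy hxy
    simp only [mem_Iio] at hx hy
    simp only [hf] at hxy
    split_ifs at hxy with h1 h2 h2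
    · omega
    · exact absurd hxy (key' _ _ h1 (by omega))
    · exact absurd hxy.symm (key' _ _ h2 (by omega))
    · omega
  have hmem : ∀ e ∈ E ∪ shiftEdges E N, e.1 < 2 * N ∧ e.2 < 2 * N := by
    intro e he
    rcases Finset.mem_union.1 he with he | he
    · have := hN e he
      omega
    · obtain ⟨d, hd, rfl⟩ := Finset.mem_image.1 he
      have := hN d hd
      simp only [Prod.map]
      omega
  rw [← hμ.measure_supersets_image (E ∪ shiftEdges E N) f f
    (hinj.mono fun x hx => by
      obtain ⟨e, he, rfl⟩ := Finset.mem_image.1 (Finset.mem_coe.1 hx)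
      exact (hmem e he).1)
    (hinj.mono fun x hx => by
      obtain ⟨e, he, rfl⟩ := Finset.mem_image.1 (Finset.mem_coe.1 hx)
      exact (hmem e he).2), Finset.image_union, supersets_union]
  congr 3
  · refine Finset.image_congr fun e he => ?_
    simp [hf, Prod.map, (hN e he).1, (hN e he).2]
  · rw [shiftEdges, shiftEdges, Finset.image_image]
    refine Finset.image_congr fun e he => ?_
    simp [hf, Prod.map]

end IsExchangeableLaw

/-! ### The second moment inequality -/

/-- Events of common probability `p` and common pairwise intersection probability `c` satisfy
`p ^ 2 ≤ c`. -/
theorem sq_le_of_measureReal_inter_eq {α : Type*} [MeasurableSpace α] (μ : Measure α)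
    [IsProbabilityMeasure μ] (B : ℕ → Set α) (hB : ∀ i, MeasurableSet (B i)) {p c : ℝ}
    (hp : ∀ i, μ.real (B i) = p) (hc : ∀ i j, i ≠ j → μ.real (B i ∩ B j) = c) : p ^ 2 ≤ c := by
  have hint : ∀ i j, ∫ x, ((B i).indicator 1 x - p) * ((B j).indicator 1 x - p) ∂μ =
      if i = j then p - p ^ 2 else c - p ^ 2 := by
    intro i j
    have hI : ∀ C, MeasurableSet C → Integrable (C.indicator (1 : α → ℝ)) μ := fun C hC =>
      (integrable_const (1 : ℝ)).indicator hC
    have he : (fun x => ((B i).indicator 1 x - p) * ((B j).indicator 1 x - p)) =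
        fun x => (B i ∩ B j).indicator (1 : α → ℝ) x - p * (B i).indicator 1 x
          - p * (B j).indicator 1 x + p ^ 2 := by
      funext x
      rw [Set.inter_indicator_one, Pi.mul_apply]
      ring
    rw [he, integral_add, integral_sub, integral_sub, integral_const_mul, integral_const_mul,
      integral_indicator_one ((hB i).inter (hB j)), integral_indicator_one (hB i),
      integral_indicator_one (hB j), hp, hp]
    · split_ifs with h
      · subst h
        rw [inter_self, hp]
        simp
        ring
      · rw [hc i j h]
        simp
        ring
    all_goals
      have h1 := hI _ (hB i)
      have h2 := hI _ (hB j)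
      have h3 := hI _ ((hB i).inter (hB j))
      fun_prop
  -- The right side is the second moment of the centred count of the first `n` events; for large `n`
  -- the sign of `c - p ^ 2` decides.
  have hcompl : ∀ n : ℕ, 0 ≤ n * (p - c) + (n : ℝ) ^ 2 * (c - p ^ 2) := by
    intro n
    have h0 : 0 ≤ ∫ x, (∑ i ∈ Finset.range n, ((B i).indicator 1 x - p)) ^ 2 ∂μ :=
      integral_nonneg fun x => sq_nonneg _
    have hI : ∀ i j, Integrable
        (fun x => ((B i).indicator 1 x - p) * ((B j).indicator 1 x - p)) μ := by
      intro i j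
      have hL : ∀ i, MemLp (fun x => (B i).indicator (1 : α → ℝ) x - p) 2 μ := fun i =>
        (memLp_indicator_const 2 (hB i) 1 (Or.inr (measure_ne_top μ _))).sub (memLp_const p)
      exact (hL i).integrable_mul (hL j)
    simp_rw [sq (∑ i ∈ Finset.range n, _), Finset.sum_mul_sum] at h0
    rw [integral_finsetSum _ fun i _ => integrable_finsetSum _ fun j _ => hI i j] at h0
    simp_rw [integral_finsetSum _ fun j _ => hI _ j, hint] at h0
    have hsum : ∀ i ∈ Finset.range n,
        ∑ j ∈ Finset.range n, (if i = j then p - p ^ 2 else c - p ^ 2) =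
          (p - c) + n * (c - p ^ 2) := by
      intro i hi
      have : ∀ j, (if i = j then p - p ^ 2 else c - p ^ 2) =
          (if i = j then p - c else 0) + (c - p ^ 2) := by
        intro j
        split_ifs <;> ring
      simp_rw [this, Finset.sum_add_distrib, Finset.sum_ite_eq, if_pos hi, Finset.sum_const,
        Finset.card_range, nsmul_eq_mul]
    rw [Finset.sum_congr rfl hsum, Finset.sum_const, Finset.card_range, nsmul_eq_mul] at h0
    linarith
  by_contra! hcon
  obtain ⟨n, hn⟩ := exists_nat_gt (|p - c| / (p ^ 2 - c))
  rw [div_lt_iff₀ (by linarith)] at hn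
  have hn0 : (0 : ℝ) < n := by
    rcases Nat.eq_zero_or_pos n with rfl | h
    · simp only [Nat.cast_zero, zero_mul] at hn
      exact absurd hn (abs_nonneg _).not_gt
    · exact_mod_cast h
  have := hcompl n
  nlinarith [le_abs_self (p - c)]

theorem exists_lt_of_finset_edges (E : Finset (ℕ × ℕ)) : ∃ N, ∀ e ∈ E, e.1 < N ∧ e.2 < N := by
  refine ⟨E.sup (fun e => e.1 + e.2) + 1, fun e he => ?_⟩
  have := Finset.le_sup (f := fun e : ℕ × ℕ => e.1 + e.2) he
  omega

theorem disjoint_image_shiftEdges_fst {E : Finset (ℕ × ℕ)} {N : ℕ} (h : ∀ e ∈ E, e.1 < N) :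
    Disjoint (E.image Prod.fst) ((shiftEdges E N).image Prod.fst) := by
  rw [Finset.disjoint_left]
  simp only [shiftEdges, Finset.image_image, Finset.mem_image, Function.comp_apply, Prod.map_fst]
  rintro _ ⟨e, he, rfl⟩ ⟨d, -, hd⟩
  have := h e he
  omega

theorem disjoint_image_shiftEdges_snd {E : Finset (ℕ × ℕ)} {N : ℕ} (h : ∀ e ∈ E, e.2 < N) :
    Disjoint (E.image Prod.snd) ((shiftEdges E N).image Prod.snd) := by
  rw [Finset.disjoint_left]
  simp only [shiftEdges, Finset.image_image, Finset.mem_image, Function.comp_apply, Prod.map_snd]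
  rintro _ ⟨e, he, rfl⟩ ⟨d, -, hd⟩
  have := h e he
  omega

namespace IsExchangeableLaw

variable {μ : Measure InfBipartiteGraph}

/-- The translates by multiples of `N` occupy disjoint vertex blocks, so any two are jointly
contained with the same probability. -/
theorem sq_measureReal_le (hμ : IsExchangeableLaw μ) [IsProbabilityMeasure μ] {N : ℕ}
    {E : Finset (ℕ × ℕ)} (hN : ∀ e ∈ E, e.1 < N ∧ e.2 < N) :
    μ.real (supersets E) ^ 2 ≤ μ.real (supersets (E ∪ shiftEdges E N)) := by
  refine sq_le_of_measureReal_inter_eq μ (fun i => supersets (shiftEdges E (i * N)))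
    (fun i => measurableSet_supersets _) (fun i => ?_) fun i j hij => ?_
  · rw [measureReal_def, hμ.measure_supersets_shiftEdges]
    rfl
  · rw [measureReal_def, hμ.measure_inter_shiftEdges_mul hN hij]
    rfl

end IsExchangeableLaw

/-! ### Exchangeable limits and extremality -/

/-- Finite permutations fix every vertex of a sufficiently far shifted edge set. -/
theorem eventually_relabel_preimage_shiftEdges (E : Finset (ℕ × ℕ)) {σ τ : Equiv.Perm ℕ}
    (hσ : IsFinitePerm σ) (hτ : IsFinitePerm τ) :
    ∀ᶠ k in atTop, relabel σ τ ⁻¹' supersets (shiftEdges E k) = supersets (shiftEdges E k) := by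
  obtain ⟨M, hM⟩ := (hσ.union hτ).bddAbove
  filter_upwards [eventually_gt_atTop M] with k hk
  have hfix : ∀ x, σ (x + k) = x + k ∧ τ (x + k) = x + k := by
    intro x
    by_contra hcon
    have : x + k ∈ {i | σ i ≠ i} ∪ {i | τ i ≠ i} := by
      rw [not_and_or] at hcon
      exact hcon
    have := hM this
    omega
  have h : (shiftEdges E k).image (Prod.map σ τ) = shiftEdges E k := by
    rw [shiftEdges, Finset.image_image]
    refine Finset.image_congr fun e _ => ?_
    simp [Prod.map, hfix]
  conv_lhs => rw [← h]
  exact relabel_preimage_supersets σ τ _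

/-- A setwise limit of restrictions of an exchangeable law to asymptotically invariant events is
exchangeable. -/
theorem IsExchangeableLaw.of_tendsto_restrict {μ ν : Measure InfBipartiteGraph}
    (hμ : IsExchangeableLaw μ) {B : ℕ → Set InfBipartiteGraph} (hB : ∀ k, MeasurableSet (B k))
    (hinv : ∀ σ τ : Equiv.Perm ℕ, IsFinitePerm σ → IsFinitePerm τ →
      ∀ᶠ k in atTop, relabel σ τ ⁻¹' B k = B k)
    {l : Filter ℕ} [l.NeBot] (hl : l ≤ atTop)
    (hν : ∀ C, MeasurableSet C → Tendsto (fun k => μ.restrict (B k) C) l (𝓝 (ν C))) :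
    IsExchangeableLaw ν := by
  intro σ τ hσ hτ
  ext C hC
  have hC' := measurable_relabel σ τ hC
  rw [Measure.map_apply (measurable_relabel σ τ) hC]
  refine tendsto_nhds_unique ((hν _ hC').congr' ?_) (hν C hC)
  filter_upwards [hl (hinv σ τ hσ hτ)] with k hk
  rw [Measure.restrict_apply hC', Measure.restrict_apply hC]
  -- Now both sets on the left are preimages, so the left side is the mass of the preimage of `C ∩ B
  -- k`.
  conv_lhs => rw [← hk]
  rw [← preimage_inter, hμ.measure_preimage hσ hτ (hC.inter (hB k))]

theorem IsExchangeableLaw.smul {ν : Measure InfBipartiteGraph} (hν : IsExchangeableLaw ν)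
    (c : ℝ≥0) : IsExchangeableLaw (c • ν) := fun σ τ hσ hτ => by
  rw [Measure.map_smul, hν σ τ hσ hτ]

/-- The exchangeable parts of an extreme exchangeable law are multiples of it. -/
theorem eq_smul_of_mem_extremePoints {μ ν ν' : Measure InfBipartiteGraph}
    (hμ : μ ∈ Set.extremePoints ℝ≥0 exchangeableLaws) (hν : IsExchangeableLaw ν)
    (hν' : IsExchangeableLaw ν') (hadd : ν + ν' = μ) : ν = ν univ • μ := by
  have := hμ.1.1
  have huniv : ν univ + ν' univ = 1 := by
    rw [← measure_univ (μ := μ), ← hadd, Measure.add_apply]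
  have hf : ν univ ≠ ⊤ := ne_top_of_le_ne_top ENNReal.one_ne_top (huniv ▸ le_self_add)
  have hf' : ν' univ ≠ ⊤ := ne_top_of_le_ne_top ENNReal.one_ne_top (huniv ▸ le_add_self)
  -- An open segment needs positive weights, so null parts are treated apart before normalising.
  rcases eq_or_ne (ν univ) 0 with h0 | h0
  · rw [h0, zero_smul, Measure.measure_univ_eq_zero.1 h0]
  rcases eq_or_ne (ν' univ) 0 with h0' | h0'
  · rw [h0', add_zero] at huniv
    rw [huniv, one_smul, ← hadd, Measure.measure_univ_eq_zero.1 h0', add_zero]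
  lift ν univ to ℝ≥0 using hf with p hp
  lift ν' univ to ℝ≥0 using hf' with q hq
  have hpq : p + q = 1 := by exact_mod_cast huniv
  have hp0 : p ≠ 0 := by exact_mod_cast h0
  have hq0 : q ≠ 0 := by exact_mod_cast h0'
  have hmem : ∀ {m : Measure InfBipartiteGraph} {r : ℝ≥0}, IsExchangeableLaw m →
      (r : ENNReal) = m univ → r ≠ 0 → r⁻¹ • m ∈ exchangeableLaws := by
    intro m r hm hr hr0
    refine ⟨⟨?_⟩, hm.smul _⟩
    rw [Measure.smul_apply, ← hr, ENNReal.smul_def, smul_eq_mul, ← ENNReal.coe_mul,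
      inv_mul_cancel₀ hr0, ENNReal.coe_one]
  have h := hμ.2 (hmem hν hp hp0) (hmem hν' hq hq0)
    ⟨p, q, pos_iff_ne_zero.2 hp0, pos_iff_ne_zero.2 hq0, hpq, by
      rw [smul_inv_smul₀ hp0, smul_inv_smul₀ hq0, hadd]⟩
  rw [← h]
  exact (smul_inv_smul₀ hp0 ν).symm

/-! ### The equivalence -/

theorem theorem8p7 {Ω : Type*} [MeasurableSpace Ω] (P : Measure Ω) [IsProbabilityMeasure P]
    (H : Ω → InfBipartiteGraph) (hH : Measurable H) (hexch : IsExchangeableLaw (P.map H)) :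
    P.map H ∈ Set.extremePoints ℝ≥0 exchangeableLaws ↔
      ∀ F₁ F₂ : FinBipartiteGraph, Disjoint F₁.V₁ F₂.V₁ → Disjoint F₁.V₂ F₂.V₂ →
        P {ω | (H ω).Contains (F₁ ∪ F₂)} =
          P {ω | (H ω).Contains F₁} * P {ω | (H ω).Contains F₂} := by
  have hprob : IsProbabilityMeasure (P.map H) := Measure.isProbabilityMeasure_map hH.aemeasurable
  have hcontains : ∀ F : FinBipartiteGraph,
      P {ω | (H ω).Contains F} = P.map H (supersets F.E) := fun F => by
    rw [Measure.map_apply hH (measurableSet_supersets _)]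
    rfl
  simp only [hcontains]
  generalize P.map H = μ at hexch hprob
  change _ ↔ ∀ F₁ F₂ : FinBipartiteGraph, Disjoint F₁.V₁ F₂.V₁ → Disjoint F₁.V₂ F₂.V₂ →
    μ (supersets (F₁.E ∪ F₂.E)) = μ (supersets F₁.E) * μ (supersets F₂.E)
  refine ⟨fun hext F₁ F₂ h₁ h₂ => ?_, fun hmul => ⟨⟨hprob, hexch⟩, ?_⟩⟩
  · set B : ℕ → Set InfBipartiteGraph := fun k => supersets (shiftEdges F₂.E k) with hBdef
    have hB : ∀ k, MeasurableSet (B k) := fun k => measurableSet_supersets _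
    have hU : (hyperfilter ℕ : Filter ℕ) ≤ atTop := Nat.hyperfilter_le_atTop
    obtain ⟨ν, hν⟩ := exists_measure_tendsto_ultrafilter μ (fun k => μ.restrict (B k))
      (fun k => Measure.restrict_le_self) (hyperfilter ℕ)
    obtain ⟨ν', hν'⟩ := exists_measure_tendsto_ultrafilter μ (fun k => μ.restrict (B k)ᶜ)
      (fun k => Measure.restrict_le_self) (hyperfilter ℕ)
    have hadd : ν + ν' = μ := by
      ext C hC
      refine tendsto_nhds_unique ((hν C hC).add (hν' C hC)) (tendsto_const_nhds.congr fun k => ?_)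
      rw [← Measure.add_apply, Measure.restrict_add_restrict_compl (hB k)]
    have hinv : ∀ σ τ : Equiv.Perm ℕ, IsFinitePerm σ → IsFinitePerm τ →
        ∀ᶠ k in atTop, relabel σ τ ⁻¹' B k = B k := fun σ τ hσ hτ =>
      eventually_relabel_preimage_shiftEdges F₂.E hσ hτ
    have heq := eq_smul_of_mem_extremePoints hext (hexch.of_tendsto_restrict hB hinv hU hν)
      (hexch.of_tendsto_restrict (fun k => (hB k).compl)
        (fun σ τ hσ hτ => (hinv σ τ hσ hτ).mono fun k hk => by rw [preimage_compl, hk]) hU hν')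
      hadd
    have huniv : ν univ = μ (supersets F₂.E) := by
      refine tendsto_nhds_unique (hν univ MeasurableSet.univ)
        (tendsto_const_nhds.congr fun k => ?_)
      rw [Measure.restrict_apply_univ, hBdef, hexch.measure_supersets_shiftEdges]
    have hinter : ν (supersets F₁.E) = μ (supersets (F₁.E ∪ F₂.E)) := by
      refine tendsto_nhds_unique (hν _ (measurableSet_supersets _))
        (tendsto_const_nhds.congr' ?_)
      filter_upwards [hU (hexch.eventually_measure_inter_shiftEdges F₁ F₂ h₁ h₂)] with k hk
      rw [Measure.restrict_apply (measurableSet_supersets _), hBdef, hk]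
    rw [← hinter, heq, huniv, Measure.smul_apply, smul_eq_mul, mul_comm]
  · rintro μ₁ ⟨hp₁, he₁⟩ μ₂ ⟨hp₂, he₂⟩ ⟨a, b, ha, hb, hab, hμ⟩
    refine measure_ext_supersets fun E => ?_
    obtain ⟨N, hN⟩ := exists_lt_of_finset_edges E
    have hreal : ∀ C, μ.real C = a * μ₁.real C + b * μ₂.real C := by
      intro C
      rw [← hμ, measureReal_add_apply, measureReal_nnreal_smul_apply,
        measureReal_nnreal_smul_apply]
    have hab' : (a : ℝ) + b = 1 := by exact_mod_cast hab
    have ha' : (0 : ℝ) < a := by exact_mod_cast ha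
    have hb' : (0 : ℝ) < b := by exact_mod_cast hb
    have hsq : μ.real (supersets (E ∪ shiftEdges E N)) = μ.real (supersets E) ^ 2 := by
      have h := hmul ⟨E.image Prod.fst, E.image Prod.snd, E, Finset.subset_product⟩
        ⟨(shiftEdges E N).image Prod.fst, (shiftEdges E N).image Prod.snd, shiftEdges E N,
          Finset.subset_product⟩ (disjoint_image_shiftEdges_fst fun e he => (hN e he).1)
          (disjoint_image_shiftEdges_snd fun e he => (hN e he).2)
      simp only [hexch.measure_supersets_shiftEdges] at h
      rw [measureReal_def, h, ENNReal.toReal_mul, ← sq]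
      rfl
    have h₁ := he₁.sq_measureReal_le hN
    have h₂ := he₂.sq_measureReal_le hN
    rw [hreal, hreal] at hsq
    have hx : μ₁.real (supersets E) = μ₂.real (supersets E) := by
      -- The left side is the gap in Jensen's inequality for the square at the two component
      -- probabilities.
      have hle : (a : ℝ) * b * (μ₁.real (supersets E) - μ₂.real (supersets E)) ^ 2 ≤ 0 := by
        have e₁ := mul_le_mul_of_nonneg_left h₁ ha'.le
        have e₂ := mul_le_mul_of_nonneg_left h₂ hb'.le
        have e₃ : (a : ℝ) * b * (μ₁.real (supersets E) - μ₂.real (supersets E)) ^ 2 =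
            a * μ₁.real (supersets E) ^ 2 + b * μ₂.real (supersets E) ^ 2 -
              (a * μ₁.real (supersets E) + b * μ₂.real (supersets E)) ^ 2 := by
          linear_combination
            (a * μ₁.real (supersets E) ^ 2 + b * μ₂.real (supersets E) ^ 2) * hab'
        linarith
      have h0 := nonpos_of_mul_nonpos_right hle (mul_pos ha' hb')
      exact sub_eq_zero.1 (pow_eq_zero_iff two_ne_zero |>.1 (le_antisymm h0 (sq_nonneg _)))
    rw [← measureReal_eq_measureReal_iff, hreal, ← hx, ← add_mul, hab', one_mul]
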